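/- Let $S_n$ ($n\ge 0$) denote the group of permutations of $\{1,\dots,n\}$, let $s_i\in S_n$ be the transposition of $i$ and $i+1$, and let $w_0=n\cdots 21$. A permutation $w$ acts on $f\in\mathbb{Z}[\beta][x_1,\dots,x_n]$ by $w\cdot f=f(x_{w(1)},\dots,x_{w(n)})$. For $1\le i<n$ put $$\partial_i f=\frac{f-s_i\cdot f}{x_i-x_{i+1}},\qquad \pi_i f=\partial_i\bigl((1+\beta x_{i+1})f\bigr).$$ The $\beta$-Grothendieck polynomials $\mathfrak{G}^{(\beta)}_w(x)\in\mathbb{Z}[\beta][x_1,\dots,x_n]$, $w\in S_n$, are defined by $$\mathfrak{G}^{(\beta)}_{w_0}(x)=x_1^{n-1}x_2^{n-2}\cdots x_{n-1},\qquad \mathfrak{G}^{(\beta)}_w(x)=\pi_i\,\mathfrak{G}^{(\beta)}_{ws_i}(x)\quad\text{if } w(i)<w(i+1),$$ where $ws_i$ is obtained from $w$ by swapping $w(i)$ and $w(i+1)$ (the result does not depend on the choice of $i$; for definiteness take the smallest such $i$). The principal specialization of $\mathfrak{G}^{(\beta)}_w$ is $$\Upsilon_w(\beta)=\mathfrak{G}^{(\beta)}_w(x)\big|_{x_1=\cdots=x_n=1}\in\mathbb{Z}[\beta].$$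 **Proposition.** For every $n\ge 0$ and every permutation $w\in S_n$, $$\Upsilon_w(\beta)=\Upsilon_{w^{-1}}(\beta)\quad\text{in }\mathbb{Z}[\beta].$$ -/

import Mathlib

/-! The symmetric group `S_n` is `Equiv.Perm (Fin n)`, so positions, values and variables are
numbered from `0`. The coefficient ring is `ℤ[β]`, that is `Polynomial ℤ` with
`β = Polynomial.X`. -/

namespace Grothendieck

/-- `f - s · f` is divisible by `x_a - x_b`, where `s` is the transposition of `a` and `b`. -/
theorem X_sub_X_dvd {R : Type*} [CommRing R] {σ : Type*} [DecidableEq σ] (a b : σ)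
    (f : MvPolynomial σ R) :
    (MvPolynomial.X a - MvPolynomial.X b : MvPolynomial σ R) ∣
      f - MvPolynomial.rename (Equiv.swap a b) f := by
  induction f using MvPolynomial.induction_on with
  | C r => simp
  | add p q hp hq =>
    have h := dvd_add hp hq
    rw [map_add]
    convert h using 1
    ring
  | mul_X p k hp =>
    have hk : (MvPolynomial.X a - MvPolynomial.X b : MvPolynomial σ R) ∣
        MvPolynomial.X k - MvPolynomial.X (Equiv.swap a b k) := by
      by_cases h1 : k = a
      · subst h1
        simp
      · by_cases h2 : k = b
        · subst h2
          rw [Equiv.swap_apply_right, ← dvd_neg, neg_sub]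
        · simp [Equiv.swap_apply_of_ne_of_ne h1 h2]
    have h := dvd_add (dvd_mul_of_dvd_left hp (MvPolynomial.X k))
      (dvd_mul_of_dvd_right hk (MvPolynomial.rename (Equiv.swap a b) p))
    rw [map_mul, MvPolynomial.rename_X]
    convert h using 1
    ring

/-- The divided difference `∂ f = (f - s · f) / (x_a - x_b)`, where `s` is the transposition of
`a` and `b`: for `a ≠ b` it is the unique polynomial whose product with `x_a - x_b` is
`f - s · f` (see `X_sub_X_mul_dividedDiff`). -/
noncomputable def dividedDiff {R : Type*} [CommRing R] {σ : Type*} [DecidableEq σ] (a b : σ)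
    (f : MvPolynomial σ R) : MvPolynomial σ R :=
  Classical.choose (X_sub_X_dvd a b f)

theorem X_sub_X_mul_dividedDiff {R : Type*} [CommRing R] {σ : Type*} [DecidableEq σ] (a b : σ)
    (f : MvPolynomial σ R) :
    (MvPolynomial.X a - MvPolynomial.X b) * dividedDiff a b f =
      f - MvPolynomial.rename (Equiv.swap a b) f :=
  (Classical.choose_spec (X_sub_X_dvd a b f)).symm

/-- The isobaric operator `π f = ∂ ((1 + β x_b) f)`; the operator `π_i` is the case where `a`
and `b` are the consecutive indices `i` and `i + 1`. -/
noncomputable def isobaric {n : ℕ} (a b : Fin n) (f : MvPolynomial (Fin n) (Polynomial ℤ)) :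
    MvPolynomial (Fin n) (Polynomial ℤ) :=
  dividedDiff a b ((1 + MvPolynomial.C Polynomial.X * MvPolynomial.X b) * f)

/-- `i` and `i + 1` are positions of `w`, and `w(i) < w(i + 1)`. -/
def IsAscent {n : ℕ} (w : Equiv.Perm (Fin n)) (i : ℕ) : Prop :=
  ∃ h : i + 1 < n, w ⟨i, Nat.lt_of_succ_lt h⟩ < w ⟨i + 1, h⟩

/-- A permutation other than the order-reversing one `w₀` has an ascent. -/
theorem exists_isAscent {n : ℕ} {w : Equiv.Perm (Fin n)} (hw : w ≠ Fin.revPerm) :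
    ∃ i, IsAscent w i := by
  by_contra! hno
  apply hw
  have hanti : StrictAnti w := by
    cases n with
    | zero => exact fun a => a.elim0
    | succ m =>
      rw [Fin.strictAnti_iff_succ_lt]
      intro i
      refine lt_of_le_of_ne (not_lt.1 fun hlt => hno i ⟨by omega, hlt⟩) fun he => ?_
      have := congrArg Fin.val (w.injective he)
      simp at this
  have hmono : StrictMono (fun i => w (Fin.rev i)) := fun a b hab =>
    hanti (Fin.rev_lt_rev.2 hab)
  have hid : (fun i => w (Fin.rev i)) = id :=
    (hmono.range_inj strictMono_id).1 (by
      rw [Set.range_id, Set.range_eq_univ]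
      exact w.surjective.comp Fin.rev_surjective)
  ext i
  have := congrFun hid (Fin.rev i)
  simp only [Fin.rev_rev, id] at this
  simp [this]

/-- The quantity on which the recursion for Grothendieck polynomials terminates. -/
theorem sum_swap_lt {n : ℕ} {w : Equiv.Perm (Fin n)} {a b : Fin n} (hab : a < b)
    (hw : w a < w b) :
    ∑ k : Fin n, (k : ℕ) * ((w * Equiv.swap a b) k : ℕ) < ∑ k : Fin n, (k : ℕ) * (w k : ℕ) := by
  have hb : b ∈ Finset.univ.erase a := by simp [hab.ne']
  rw [← Finset.add_sum_erase _ _ (Finset.mem_univ a), ← Finset.add_sum_erase _ _ hb,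
    ← Finset.add_sum_erase Finset.univ (fun k : Fin n => (k : ℕ) * (w k : ℕ))
      (Finset.mem_univ a), ← Finset.add_sum_erase _ (fun k : Fin n => (k : ℕ) * (w k : ℕ)) hb]
  have hrest : ∑ k ∈ (Finset.univ.erase a).erase b, (k : ℕ) * ((w * Equiv.swap a b) k : ℕ) =
      ∑ k ∈ (Finset.univ.erase a).erase b, (k : ℕ) * (w k : ℕ) := by
    refine Finset.sum_congr rfl fun k hk => ?_
    simp only [Finset.mem_erase, Finset.mem_univ, and_true] at hk
    rw [Equiv.Perm.mul_apply, Equiv.swap_apply_of_ne_of_ne hk.2 hk.1]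
  rw [hrest, Equiv.Perm.mul_apply, Equiv.Perm.mul_apply, Equiv.swap_apply_left,
    Equiv.swap_apply_right]
  have h1 : (a : ℕ) < b := hab
  have h2 : (w a : ℕ) < w b := hw
  nlinarith

open scoped Classical in
/-- The `β`-Grothendieck polynomial of `w ∈ S_n`: it is `x_1^(n-1) x_2^(n-2) ⋯ x_(n-1)` for
`w = w₀`, and otherwise `π_i` applied to the polynomial of `w s_i`, where `i` is an ascent of `w`.
The result does not depend on the ascents used, since the `π_i` satisfy the Coxeter relations;
to have a definite recursion we take the smallest one. -/
noncomputable def grothendieck {n : ℕ} (w : Equiv.Perm (Fin n)) :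
    MvPolynomial (Fin n) (Polynomial ℤ) :=
  if hw : w = Fin.revPerm then ∏ k : Fin n, MvPolynomial.X k ^ (n - 1 - (k : ℕ))
  else
    have hi : IsAscent w (Nat.find (exists_isAscent hw)) := Nat.find_spec (exists_isAscent hw)
    let a : Fin n := ⟨Nat.find (exists_isAscent hw), Nat.lt_of_succ_lt hi.1⟩
    let b : Fin n := ⟨Nat.find (exists_isAscent hw) + 1, hi.1⟩
    isobaric a b (grothendieck (w * Equiv.swap a b))
  termination_by ∑ k : Fin n, (k : ℕ) * (w k : ℕ)
  decreasing_by exact sum_swap_lt (Fin.mk_lt_mk.2 (Nat.lt_succ_self _)) hi.2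

/-- The principal specialization `Υ_w(β) ∈ ℤ[β]`: all variables `x_i` of the `β`-Grothendieck
polynomial of `w` are set to `1`. -/
noncomputable def principalSpecialization {n : ℕ} (w : Equiv.Perm (Fin n)) : Polynomial ℤ :=
  MvPolynomial.eval (fun _ => 1) (grothendieck w)

end Grothendieck

/-! The argument uses the Fomin–Kirillov generating function in the `0`-Hecke algebra with `u_i² = β
u_i`. Put `h_i(x) = 1 + x u_i`. The staircase product of the `h_i(x_j)` has the Grothendieck
polynomials as its coefficients in the basis indexed by permutations. Its top coefficient is the
staircase monomial (`generating_revPerm`). The Yang–Baxter relation makes full segments in two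
variables commute (`segment_comm`), which gives the exchange rule `hFactor_mul_staircase`; comparing
coefficients in that rule yields the `π_i` recursion (`isobaric_genericSeries`).

When all variables are equal, the staircase product equals the product of its factors in the
opposite order (`staircase_eq_revStaircase`). The anti-automorphism fixing each `u_i` reverses
products and sends the basis element of `w` to that of `w⁻¹`. It therefore fixes the specialized
generating function, so the coefficients at `w` and `w⁻¹` agree (`generating_const_inv`).

The algebra itself is never constructed: its elements are represented by operators on functions on
`S_n`. -/

namespace Grothendieck

/-! ### Yang–Baxter relation and staircase products -/

section YangBaxter

variable {R A : Type*} [CommRing R] [Ring A] [Algebra R A]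

/-- The factor `1 + x u_j`. -/
def hFactor (u : ℕ → A) (j : ℕ) (x : R) : A := 1 + x • u j

/-- The product `h_i(x) h_{i+1}(x) ⋯ h_{i+k-1}(x)`. -/
def segment (u : ℕ → A) : ℕ → ℕ → R → A
  | _, 0, _ => 1
  | i, k + 1, x => hFactor u i x * segment u (i + 1) k x

/-- The product `h_{i+k-1}(x) ⋯ h_{i+1}(x) h_i(x)`. -/
def revSegment (u : ℕ → A) : ℕ → ℕ → R → A
  | _, 0, _ => 1
  | i, k + 1, x => revSegment u (i + 1) k x * hFactor u i x

/-- The product of the segments from `j` to `i + k - 1` in the variable `X j`, where `j` decreases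
from `i + k - 1` to `i`. -/
def staircase (u : ℕ → A) (X : ℕ → R) : ℕ → ℕ → A
  | _, 0 => 1
  | i, k + 1 => staircase u X (i + 1) k * segment u i (k + 1) (X i)

/-- The product of the factors of `staircase` in the opposite order. -/
def revStaircase (u : ℕ → A) (X : ℕ → R) : ℕ → ℕ → A
  | _, 0 => 1
  | i, k + 1 => revSegment u i (k + 1) (X i) * revStaircase u X (i + 1) k

/-- The relations of the `0`-Hecke algebra with parameter `b`. -/
structure HeckeRelations (b : R) (u : ℕ → A) : Prop where
  sq : ∀ i, u i * u i = b • u i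
  comm : ∀ i j, i + 2 ≤ j → u i * u j = u j * u i
  braid : ∀ i, u i * u (i + 1) * u i = u (i + 1) * u i * u (i + 1)

theorem segment_succ (u : ℕ → A) (i k : ℕ) (x : R) :
    segment u i (k + 1) x = hFactor u i x * segment u (i + 1) k x := rfl

theorem revSegment_succ (u : ℕ → A) (i k : ℕ) (x : R) :
    revSegment u i (k + 1) x = revSegment u (i + 1) k x * hFactor u i x := rfl

variable {b : R} {u : ℕ → A}

theorem hFactor_comm_self (j : ℕ) (x y : R) :
    hFactor u j x * hFactor u j y = hFactor u j y * hFactor u j x := by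
  simp only [hFactor, mul_add, add_mul, one_mul, mul_one, smul_mul_assoc, mul_smul_comm]
  module

theorem HeckeRelations.hFactor_comm (hu : HeckeRelations b u) {i j : ℕ} (hij : i + 2 ≤ j)
    (x y : R) : Commute (hFactor u i x) (hFactor u j y) := by
  have : Commute (u i) (u j) := hu.comm i j hij
  exact (Commute.one_left _).add_left
    (((Commute.one_right _).add_right (this.smul_right y)).smul_left x)

theorem HeckeRelations.hFactor_comm_segment (hu : HeckeRelations b u) {i j : ℕ} (k : ℕ)
    (hij : i + 2 ≤ j) (x y : R) : Commute (hFactor u i x) (segment u j k y) := by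
  induction k generalizing j with
  | zero => exact Commute.one_right _
  | succ k ih => exact (hu.hFactor_comm hij x y).mul_right (ih (by omega))

theorem HeckeRelations.hFactor_comm_staircase (hu : HeckeRelations b u) {i j : ℕ} (k : ℕ)
    (hij : i + 2 ≤ j) (x : R) (X : ℕ → R) :
    Commute (hFactor u i x) (staircase u X j k) := by
  induction k generalizing j with
  | zero => exact Commute.one_right _
  | succ k ih => exact (ih (by omega)).mul_right (hu.hFactor_comm_segment _ hij x _)

/-- The last factor on the left stands for `(1 + b y) h_{i+1}(y)⁻¹ h_{i+1}(x)`; clearing the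
denominator avoids inverting `1 + b y`. -/
theorem HeckeRelations.yangBaxter (hu : HeckeRelations b u) (i : ℕ) (x y : R) :
    hFactor u i y * hFactor u (i + 1) y * hFactor u i x *
        ((1 + b * y) • (1 : A) + (x - y) • u (i + 1)) =
      (1 + b * y) • (hFactor u i x * hFactor u (i + 1) x * hFactor u i y) := by
  have h1 := hu.sq i
  have h2 := hu.sq (i + 1)
  have h3 := hu.braid i
  simp only [hFactor]
  generalize u i = p at *
  generalize u (i + 1) = q at *
  have h1' (z : A) : p * (p * z) = b • (p * z) := by rw [← mul_assoc, h1, smul_mul_assoc]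
  have h3' : q * (p * q) = p * (q * p) := by rw [← mul_assoc, ← mul_assoc, h3]
  simp only [mul_add, add_mul, one_mul, mul_one, smul_mul_assoc, mul_smul_comm, mul_assoc, h1, h2,
    h1', h3', smul_add, smul_smul]
  module

theorem HeckeRelations.hFactor_cancel (hu : HeckeRelations b u) (j : ℕ) (x y : R) :
    ((1 + b * y) • (1 : A) - y • u j) * hFactor u j x =
      (1 + b * y) • (1 : A) + (x - y) • u j := by
  simp only [hFactor, mul_add, sub_mul, one_mul, mul_one, smul_mul_assoc, mul_smul_comm, hu.sq,
    smul_smul]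
  module

/-- Induction on the length: the shorter segments commute, and Yang–Baxter treats the two leftmost
indices, up to a factor `1 + b y` that `hy` cancels. -/
theorem HeckeRelations.segment_comm (hu : HeckeRelations b u) (i k : ℕ) (x : R) {y : R}
    (hy : ∀ p q : A, (1 + b * y) • p = (1 + b * y) • q → p = q) :
    segment u i k y * segment u i k x = segment u i k x * segment u i k y := by
  induction k generalizing i with
  | zero => rfl
  | succ k ih =>
    cases k with
    | zero => simpa [segment] using hFactor_comm_self i y x
    | succ k =>
      have key (x y : R) : segment u i (k + 2) y * segment u i (k + 2) x =
          hFactor u i y * hFactor u (i + 1) y * hFactor u i x *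
            (segment u (i + 2) k y * segment u (i + 1) (k + 1) x) := by
        have := (hu.hFactor_comm_segment k (le_refl (i + 2)) x y).eq
        calc segment u i (k + 2) y * segment u i (k + 2) x
            = hFactor u i y * hFactor u (i + 1) y *
              (segment u (i + 2) k y * hFactor u i x) * segment u (i + 1) (k + 1) x := by
                simp only [segment, mul_assoc]
          _ = _ := by rw [← this]; simp only [mul_assoc]
      -- This is the induction hypothesis with the leading factor split off; it determines `(1 + b
      -- y) C` in terms of `C'`.
      have hC : hFactor u (i + 1) y * (segment u (i + 2) k y * segment u (i + 1) (k + 1) x) =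
          hFactor u (i + 1) x * (segment u (i + 2) k x * segment u (i + 1) (k + 1) y) := by
        rw [← mul_assoc, ← mul_assoc]
        exact ih (i + 1)
      rw [key, key]
      generalize segment u (i + 2) k y * segment u (i + 1) (k + 1) x = C at *
      generalize segment u (i + 2) k x * segment u (i + 1) (k + 1) y = C' at *
      have hC' : (1 + b * y) • C = ((1 + b * y) • (1 : A) + (x - y) • u (i + 1)) * C' := by
        rw [← hu.hFactor_cancel, mul_assoc, ← hC, ← mul_assoc, hu.hFactor_cancel]
        simp
      apply hy
      rw [← mul_smul_comm, hC', ← mul_assoc, hu.yangBaxter, smul_mul_assoc]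

theorem staircase_congr {X Y : ℕ → R} (i k : ℕ) (h : ∀ j, i ≤ j → X j = Y j) :
    staircase u X i k = staircase u Y i k := by
  induction k generalizing i with
  | zero => rfl
  | succ k ih => rw [staircase, staircase, ih (i + 1) fun j hj => h j (by omega), h i le_rfl]

/-- The extra factor completes the segment starting at `j + 1` to one starting at `j`. Two full
segments then stand side by side, and they commute. -/
theorem HeckeRelations.hFactor_mul_staircase (hu : HeckeRelations b u) {X : ℕ → R} {j : ℕ}
    (hX : ∀ p q : A, (1 + b * X (j + 1)) • p = (1 + b * X (j + 1)) • q → p = q) (i k : ℕ)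
    (hij : i ≤ j) (hjk : j < i + k) :
    hFactor u j (X (j + 1)) * staircase u X i k =
      hFactor u j (X j) * staircase u (X ∘ Equiv.swap j (j + 1)) i k := by
  induction k generalizing i with
  | zero => omega
  | succ k ih =>
    obtain hlt | rfl := hij.lt_or_eq
    · have hi : (X ∘ Equiv.swap j (j + 1)) i = X i := by
        rw [Function.comp_apply, Equiv.swap_apply_of_ne_of_ne (by omega) (by omega)]
      rw [staircase, staircase, ← mul_assoc, ← mul_assoc, ih (i + 1) (by omega) (by omega), hi]
    · cases k with
      | zero => simp [staircase, segment, hFactor_comm_self]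
      | succ k =>
        have h0 : staircase u (X ∘ Equiv.swap i (i + 1)) (i + 2) k = staircase u X (i + 2) k :=
          staircase_congr _ _ fun l hl => by
            rw [Function.comp_apply, Equiv.swap_apply_of_ne_of_ne (by omega) (by omega)]
        have hc := hu.hFactor_comm_staircase k (le_refl (i + 2))
        have hs (x y : R) : hFactor u i x * (staircase u X (i + 2) k *
            segment u (i + 1) (k + 1) x * segment u i (k + 2) y) =
            staircase u X (i + 2) k * (segment u i (k + 2) x * segment u i (k + 2) y) := by
          rw [segment_succ u i (k + 1) x, ← mul_assoc, ← mul_assoc, (hc x X).eq]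
          simp only [mul_assoc]
        rw [staircase, staircase, staircase, staircase, h0]
        simp only [Function.comp_apply, Equiv.swap_apply_left, Equiv.swap_apply_right]
        rw [hs, hs, hu.segment_comm i (k + 2) (X i) hX]

theorem HeckeRelations.staircase_mul_segment (hu : HeckeRelations b u) (x : R) (i k : ℕ) :
    staircase u (fun _ => x) (i + 1) k * segment u i (k + 1) x =
      revSegment u i (k + 1) x * staircase u (fun _ => x) (i + 1) k := by
  induction k generalizing i with
  | zero => simp [staircase, segment, revSegment]
  | succ k ih =>
    have hc := (hu.hFactor_comm_staircase k (le_refl (i + 2)) x fun _ => x).eq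
    calc staircase u (fun _ => x) (i + 1) (k + 1) * segment u i (k + 2) x
        = (staircase u (fun _ => x) (i + 2) k * segment u (i + 1) (k + 1) x) *
            (hFactor u i x * segment u (i + 1) (k + 1) x) := rfl
      _ = revSegment u (i + 1) (k + 1) x * (staircase u (fun _ => x) (i + 2) k *
            hFactor u i x) * segment u (i + 1) (k + 1) x := by
          rw [ih]; simp only [mul_assoc]
      _ = revSegment u i (k + 2) x * (staircase u (fun _ => x) (i + 2) k *
            segment u (i + 1) (k + 1) x) := by
          rw [← hc, revSegment_succ u i]; simp only [mul_assoc]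

/-- With equal variables the product of the factors is the same in the opposite order. -/
theorem HeckeRelations.staircase_eq_revStaircase (hu : HeckeRelations b u) (x : R) (i k : ℕ) :
    staircase u (fun _ => x) i k = revStaircase u (fun _ => x) i k := by
  induction k generalizing i with
  | zero => rfl
  | succ k ih => rw [staircase, hu.staircase_mul_segment, revStaircase, ih]

end YangBaxter

/-! ### The `0`-Hecke algebra acting on functions on `S_n` -/

section Operators

variable {R : Type*} [CommRing R] {n : ℕ}

/-- Right multiplication by the generator that belongs to the transposition of the positions `p`
and `q`, on elements of the `0`-Hecke algebra written as functions on permutations. -/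
def descentOp (b : R) (p q : Fin n) : Module.End R (Equiv.Perm (Fin n) → R) where
  toFun F w := if w q < w p then F (w * Equiv.swap p q) + b * F w else 0
  map_add' F G := by
    ext w
    simp only [Pi.add_apply]
    split_ifs <;> ring
  map_smul' c F := by
    ext w
    simp only [Pi.smul_apply, smul_eq_mul, RingHom.id_apply]
    split_ifs <;> ring

theorem descentOp_apply (b : R) (p q : Fin n) (F : Equiv.Perm (Fin n) → R)
    (w : Equiv.Perm (Fin n)) :
    descentOp b p q F w = if w q < w p then F (w * Equiv.swap p q) + b * F w else 0 := rfl

theorem descentOp_sq (b : R) (p q : Fin n) :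
    descentOp b p q * descentOp b p q = b • descentOp b p q := by
  refine LinearMap.ext fun F => funext fun w => ?_
  simp only [Module.End.mul_apply, LinearMap.smul_apply, Pi.smul_apply, descentOp_apply,
    Equiv.Perm.mul_apply, Equiv.swap_apply_left, Equiv.swap_apply_right, smul_eq_mul]
  split_ifs with h1 h2
  · exact absurd h1 h2.asymm
  · ring
  · ring

theorem descentOp_comm (b : R) {p q r s : Fin n} (hpr : p ≠ r) (hps : p ≠ s) (hqr : q ≠ r)
    (hqs : q ≠ s) :
    descentOp b p q * descentOp b r s = descentOp b r s * descentOp b p q := by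
  have hs (w : Equiv.Perm (Fin n)) :
      w * Equiv.swap r s * Equiv.swap p q = w * Equiv.swap p q * Equiv.swap r s := by
    have : Equiv.Perm.Disjoint (Equiv.swap p q) (Equiv.swap r s) := by
      intro x
      by_cases hx : x = p ∨ x = q
      · right
        rcases hx with rfl | rfl
        · exact Equiv.swap_apply_of_ne_of_ne hpr hps
        · exact Equiv.swap_apply_of_ne_of_ne hqr hqs
      · rw [not_or] at hx
        exact .inl (Equiv.swap_apply_of_ne_of_ne hx.1 hx.2)
    rw [mul_assoc, mul_assoc, this.commute.eq]
  refine LinearMap.ext fun F => funext fun w => ?_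
  simp only [Module.End.mul_apply, descentOp_apply, Equiv.Perm.mul_apply,
    Equiv.swap_apply_of_ne_of_ne hpr hps, Equiv.swap_apply_of_ne_of_ne hqr hqs,
    Equiv.swap_apply_of_ne_of_ne hpr.symm hqr.symm, Equiv.swap_apply_of_ne_of_ne hps.symm hqs.symm,
    hs]
  split_ifs <;> ring

theorem descentOp_braid (b : R) {p q r : Fin n} (hpq : p ≠ q) (hqr : q ≠ r) (hpr : p ≠ r) :
    descentOp b p q * descentOp b q r * descentOp b p q =
      descentOp b q r * descentOp b p q * descentOp b q r := by
  have hs (w : Equiv.Perm (Fin n)) : w * Equiv.swap q r * Equiv.swap p q * Equiv.swap q r =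
      w * Equiv.swap p q * Equiv.swap q r * Equiv.swap p q := by
    have h1 := Equiv.swap_mul_swap_mul_swap hpq hpr
    have h2 := Equiv.swap_mul_swap_mul_swap hqr.symm hpr.symm
    rw [Equiv.swap_comm q p, Equiv.swap_comm r q, Equiv.swap_comm p r, ← h1] at h2
    simp only [mul_assoc] at h2 ⊢
    rw [h2]
  have e1 : Equiv.swap p q r = r := Equiv.swap_apply_of_ne_of_ne hpr.symm hqr.symm
  have e2 : Equiv.swap q r p = p := Equiv.swap_apply_of_ne_of_ne hpq hpr
  refine LinearMap.ext fun F => funext fun w => ?_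
  have := w.injective.ne hpq
  have := w.injective.ne hqr
  have := w.injective.ne hpr
  simp only [Module.End.mul_apply, descentOp_apply, Equiv.Perm.mul_apply, e1, e2,
    Equiv.swap_apply_left, Equiv.swap_apply_right, hs]
  have hss (w : Equiv.Perm (Fin n)) (x y : Fin n) : w * Equiv.swap x y * Equiv.swap x y = w := by
    rw [mul_assoc, Equiv.swap_mul_self, mul_one]
  simp only [hss]
  -- Every condition compares two of `w p`, `w q`, `w r`; inconsistent orderings are discarded.
  split_ifs <;> first | ring1 | (exfalso; omega)

/-- The generator for the positions `j` and `j + 1`, and `0` if these are not positions. -/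
def simpleOp (n : ℕ) (b : R) (j : ℕ) : Module.End R (Equiv.Perm (Fin n) → R) :=
  if h : j + 1 < n then descentOp b ⟨j, Nat.lt_of_succ_lt h⟩ ⟨j + 1, h⟩ else 0

theorem heckeRelations_simpleOp (n : ℕ) (b : R) : HeckeRelations b (simpleOp n b) where
  sq i := by
    unfold simpleOp
    split_ifs
    · exact descentOp_sq _ _ _
    · simp
  comm i j hij := by
    unfold simpleOp
    split_ifs
    · apply descentOp_comm <;> simp only [ne_eq, Fin.mk.injEq] <;> omega
    all_goals simp
  braid i := by
    unfold simpleOp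
    split_ifs
    · apply descentOp_braid <;> simp only [ne_eq, Fin.mk.injEq] <;> omega
    all_goals simp

/-- The composition of a function on permutations with the inversion of permutations. -/
def invOp (n : ℕ) (R : Type*) [CommRing R] : Module.End R (Equiv.Perm (Fin n) → R) :=
  LinearMap.funLeft R R (fun w => w⁻¹)

theorem invOp_apply (F : Equiv.Perm (Fin n) → R) (w : Equiv.Perm (Fin n)) :
    invOp n R F w = F w⁻¹ := rfl

/-- Left multiplication by the generators of the `0`-Hecke algebra. -/
def leftOp (n : ℕ) (b : R) (j : ℕ) : Module.End R (Equiv.Perm (Fin n) → R) :=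
  invOp n R * simpleOp n b j * invOp n R

theorem invOp_mul_invOp : invOp n R * invOp n R = 1 := by
  refine LinearMap.ext fun F => funext fun w => ?_
  simp [invOp_apply]

theorem invOp_mul_simpleOp (b : R) (j : ℕ) :
    invOp n R * simpleOp n b j = leftOp n b j * invOp n R := by
  rw [leftOp, mul_assoc, invOp_mul_invOp, mul_one]

theorem invOp_single_one : invOp n R (Pi.single 1 1) = Pi.single 1 1 := by
  ext w
  simp [invOp_apply, Pi.single_apply]

theorem swap_lt_swap_iff {p q a c : Fin n} (hpq : (p : ℕ) + 1 = q) (h : ¬(a = p ∧ c = q))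
    (h' : ¬(a = q ∧ c = p)) : Equiv.swap p q a < Equiv.swap p q c ↔ a < c := by
  simp only [Equiv.swap_apply_def]
  split_ifs <;> omega

/-- Left and right multiplication commute. The two descent conditions interact only if `w` maps `{r,
s}` onto `{p, q}`, and then both multiplications by the transposition give the same permutation. -/
theorem descentOp_invOp_comm (b : R) {p q r s : Fin n} (hpq : (p : ℕ) + 1 = q)
    (hrs : (r : ℕ) + 1 = s) :
    Commute (invOp n R * descentOp b p q * invOp n R) (descentOp b r s) := by
  show _ = _
  refine LinearMap.ext fun F => funext fun w => ?_
  simp only [Module.End.mul_apply, invOp_apply, descentOp_apply, Equiv.Perm.mul_apply, mul_inv_rev,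
    inv_inv, Equiv.swap_inv]
  have hmul : w * Equiv.swap r s = Equiv.swap (w r) (w s) * w := Equiv.mul_swap_eq_swap_mul w r s
  have hpq' : p < q := by omega
  have hrs' : r < s := by omega
  by_cases h : w r = p ∧ w s = q
  · obtain ⟨h1, h2⟩ := h
    have h1' : w⁻¹ p = r := by simp [← h1]
    have h2' : w⁻¹ q = s := by simp [← h2]
    simp [h1, h2, h1', h2', hpq'.not_gt, hrs'.not_gt]
  by_cases h' : w r = q ∧ w s = p
  · obtain ⟨h1, h2⟩ := h'
    have h1' : w⁻¹ q = r := by simp [← h1]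
    have h2' : w⁻¹ p = s := by simp [← h2]
    rw [h1, h2, Equiv.swap_comm q p] at hmul
    simp [h1, h2, h1', h2', hpq', hrs', hpq'.not_gt, hrs'.not_gt, hmul]
  · have hlt : Equiv.swap p q (w s) < Equiv.swap p q (w r) ↔ w s < w r :=
      swap_lt_swap_iff hpq (by tauto) (by tauto)
    have hlt' : Equiv.swap r s (w⁻¹ q) < Equiv.swap r s (w⁻¹ p) ↔ w⁻¹ q < w⁻¹ p := by
      apply swap_lt_swap_iff hrs <;> simp only [Equiv.Perm.inv_eq_iff_eq] <;> tauto
    simp only [hlt, hlt', mul_assoc]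
    split_ifs <;> ring

theorem leftOp_comm_simpleOp (b : R) (i j : ℕ) : Commute (leftOp n b i) (simpleOp n b j) := by
  unfold leftOp simpleOp
  split_ifs
  · exact descentOp_invOp_comm b rfl rfl
  all_goals simp

theorem leftOp_single_one (b : R) (j : ℕ) :
    leftOp n b j (Pi.single 1 1) = simpleOp n b j (Pi.single 1 1) := by
  rw [leftOp, Module.End.mul_apply, Module.End.mul_apply, invOp_single_one]
  unfold simpleOp
  split_ifs with h
  · ext w
    simp only [invOp_apply, descentOp_apply]
    have key (v : Equiv.Perm (Fin n)) (hv : v * Equiv.swap ⟨j, Nat.lt_of_succ_lt h⟩ ⟨j + 1, h⟩ = 1) :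
        v = Equiv.swap ⟨j, Nat.lt_of_succ_lt h⟩ ⟨j + 1, h⟩ := by
      rw [eq_inv_of_mul_eq_one_left hv, Equiv.swap_inv]
    by_cases h1 : w = 1
    · simp [h1]
    by_cases h2 : w = Equiv.swap ⟨j, Nat.lt_of_succ_lt h⟩ ⟨j + 1, h⟩
    · simp [h2]
    · have h3 : w * Equiv.swap ⟨j, Nat.lt_of_succ_lt h⟩ ⟨j + 1, h⟩ ≠ 1 := fun hw => h2 (key _ hw)
      have h4 : w⁻¹ * Equiv.swap ⟨j, Nat.lt_of_succ_lt h⟩ ⟨j + 1, h⟩ ≠ 1 := fun hw =>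
        h2 (by rw [← inv_inv w, key _ hw, Equiv.swap_inv])
      simp [h1, h3, h4]
  · simp
end Operators

/-! ### Symmetry under inversion at equal variables -/

section InverseSymmetry

variable {R : Type*} [CommRing R] {n : ℕ}

theorem map_hFactor {A : Type*} [Ring A] [Algebra R A] {u v : ℕ → A} {e : A}
    (h : ∀ j, e * u j = v j * e) (j : ℕ) (x : R) : e * hFactor u j x = hFactor v j x * e := by
  simp [hFactor, mul_add, add_mul, h]

theorem map_segment {A : Type*} [Ring A] [Algebra R A] {u v : ℕ → A} {e : A}
    (h : ∀ j, e * u j = v j * e) (i k : ℕ) (x : R) :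
    e * segment u i k x = segment v i k x * e := by
  induction k generalizing i with
  | zero => simp [segment]
  | succ k ih => rw [segment, segment, ← mul_assoc, map_hFactor h, mul_assoc, ih, mul_assoc]

theorem map_staircase {A : Type*} [Ring A] [Algebra R A] {u v : ℕ → A} {e : A}
    (h : ∀ j, e * u j = v j * e) (X : ℕ → R) (i k : ℕ) :
    e * staircase u X i k = staircase v X i k * e := by
  induction k generalizing i with
  | zero => simp [staircase]
  | succ k ih => rw [staircase, staircase, ← mul_assoc, ih, mul_assoc, map_segment h, mul_assoc]

/-- `l` is a left multiplication and `r` is a right multiplication by the same element of the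
`0`-Hecke algebra. -/
structure SameElement (b : R) (l r : Module.End R (Equiv.Perm (Fin n) → R)) : Prop where
  left_mem : l ∈ Subalgebra.centralizer R (Set.range (simpleOp n b))
  right_mem : r ∈ Subalgebra.centralizer R
    (Subalgebra.centralizer R (Set.range (simpleOp n b)) : Set (Module.End R _))
  apply_single_one : l (Pi.single 1 1) = r (Pi.single 1 1)

variable {b : R}

theorem SameElement.one : SameElement b (1 : Module.End R (Equiv.Perm (Fin n) → R)) 1 :=
  ⟨one_mem _, one_mem _, rfl⟩

theorem SameElement.mul {l r l' r' : Module.End R (Equiv.Perm (Fin n) → R)}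
    (h : SameElement b l r) (h' : SameElement b l' r') : SameElement b (l * l') (r' * r) where
  left_mem := mul_mem h.left_mem h'.left_mem
  right_mem := mul_mem h'.right_mem h.right_mem
  apply_single_one := by
    -- The double centralizer makes every left multiplication commute with every right one, so both
    -- products can be evaluated at the unit.
    have hc : l * r' = r' * l := Subalgebra.mem_centralizer_iff R |>.1 h'.right_mem l h.left_mem
    rw [Module.End.mul_apply, h'.apply_single_one, ← Module.End.mul_apply, hc,
      Module.End.mul_apply, h.apply_single_one, Module.End.mul_apply]

theorem sameElement_hFactor (j : ℕ) (x : R) :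
    SameElement b (hFactor (leftOp n b) j x) (hFactor (simpleOp n b) j x) where
  left_mem := by
    refine add_mem (one_mem _) (Subalgebra.smul_mem _ ?_ x)
    rw [Subalgebra.mem_centralizer_iff]
    rintro _ ⟨i, rfl⟩
    exact (leftOp_comm_simpleOp b j i).eq.symm
  right_mem := by
    refine add_mem (one_mem _) (Subalgebra.smul_mem _ ?_ x)
    exact Set.subset_centralizer_centralizer ⟨j, rfl⟩
  apply_single_one := by simp [hFactor, leftOp_single_one]

theorem sameElement_segment (i k : ℕ) (x : R) :
    SameElement b (segment (leftOp n b) i k x) (revSegment (simpleOp n b) i k x) := by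
  induction k generalizing i with
  | zero => exact .one
  | succ k ih => exact (sameElement_hFactor i x).mul (ih _)

theorem sameElement_staircase (X : ℕ → R) (i k : ℕ) :
    SameElement b (staircase (leftOp n b) X i k) (revStaircase (simpleOp n b) X i k) := by
  induction k generalizing i with
  | zero => exact .one
  | succ k ih => exact (ih _).mul (sameElement_segment i (k + 1) (X i))

/-- The generating function of the Grothendieck polynomials of `S_n`, as an element of the
`0`-Hecke algebra. -/
def generating (n : ℕ) (b : R) (X : ℕ → R) : Equiv.Perm (Fin n) → R :=
  staircase (simpleOp n b) X 0 (n - 1) (Pi.single 1 1)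

/-- Inversion turns right multiplications into left ones. At the unit these equal right
multiplication by the factors in reversed order, which changes nothing at equal variables. -/
theorem generating_const_inv (b x : R) (w : Equiv.Perm (Fin n)) :
    generating n b (fun _ => x) w⁻¹ = generating n b (fun _ => x) w := by
  rw [← invOp_apply (generating n b _), generating, ← Module.End.mul_apply, map_staircase (invOp_mul_simpleOp b),
    Module.End.mul_apply, invOp_single_one, (sameElement_staircase _ _ _).apply_single_one,
    ← (heckeRelations_simpleOp n b).staircase_eq_revStaircase]

end InverseSymmetry

/-! ### Change of coefficient ring -/

section Functoriality

variable {R S : Type*} [CommRing R] [CommRing S] {n : ℕ}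

theorem comp_simpleOp (φ : R →+* S) (b : R) (j : ℕ) (F : Equiv.Perm (Fin n) → R) :
    φ ∘ simpleOp n b j F = simpleOp n (φ b) j (φ ∘ F) := by
  unfold simpleOp
  ext w
  split_ifs
  · simp only [Function.comp_apply, descentOp_apply]
    split_ifs <;> simp
  · simp

theorem comp_hFactor (φ : R →+* S) (b : R) (j : ℕ) (x : R) (F : Equiv.Perm (Fin n) → R) :
    φ ∘ hFactor (simpleOp n b) j x F = hFactor (simpleOp n (φ b)) j (φ x) (φ ∘ F) := by
  ext w
  have := congrFun (comp_simpleOp φ b j F) w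
  simp only [Function.comp_apply] at this
  simp [hFactor, this]

theorem comp_segment (φ : R →+* S) (b : R) (i k : ℕ) (x : R) (F : Equiv.Perm (Fin n) → R) :
    φ ∘ segment (simpleOp n b) i k x F = segment (simpleOp n (φ b)) i k (φ x) (φ ∘ F) := by
  induction k generalizing i with
  | zero => rfl
  | succ k ih =>
    rw [segment, segment, Module.End.mul_apply, Module.End.mul_apply, comp_hFactor, ih]

theorem comp_staircase (φ : R →+* S) (b : R) (X : ℕ → R) (i k : ℕ)
    (F : Equiv.Perm (Fin n) → R) :
    φ ∘ staircase (simpleOp n b) X i k F = staircase (simpleOp n (φ b)) (φ ∘ X) i k (φ ∘ F) := by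
  induction k generalizing i F with
  | zero => rfl
  | succ k ih =>
    rw [staircase, staircase, Module.End.mul_apply, Module.End.mul_apply, ih, comp_segment]
    rfl

theorem comp_generating (φ : R →+* S) (b : R) (X : ℕ → R) :
    φ ∘ generating n b X = generating n (φ b) (φ ∘ X) := by
  have : φ ∘ (Pi.single 1 1 : Equiv.Perm (Fin n) → R) = Pi.single 1 1 := by
    ext w
    simp [Pi.single_apply, apply_ite φ]
  rw [generating, comp_staircase, this, generating]

end Functoriality

/-! ### The coefficient of the longest permutation -/

section TopCoefficient

variable {R : Type*} [CommRing R] {n : ℕ}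

/-- The number of inversions of a permutation. -/
def inversionCount (w : Equiv.Perm (Fin n)) : ℕ :=
  (Finset.univ.filter fun z : Fin n × Fin n => z.1 < z.2 ∧ w z.2 < w z.1).card

/-- Applying the adjacent transposition to both positions carries the old inversions to the new
ones, apart from the new inversion `(p, q)`. -/
theorem inversionCount_mul_swap {w : Equiv.Perm (Fin n)} {p q : Fin n} (hpq : (p : ℕ) + 1 = q)
    (hw : w p < w q) : inversionCount (w * Equiv.swap p q) = inversionCount w + 1 := by
  have hlt : p < q := by omega
  set e := (Equiv.swap p q).prodCongr (Equiv.swap p q) with he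
  have hset : (Finset.univ.filter fun z : Fin n × Fin n =>
      z.1 < z.2 ∧ (w * Equiv.swap p q) z.2 < (w * Equiv.swap p q) z.1) =
      insert (p, q) ((Finset.univ.filter fun z : Fin n × Fin n =>
        z.1 < z.2 ∧ w z.2 < w z.1).map e.toEmbedding) := by
    ext ⟨a, c⟩
    rw [Finset.mem_filter, Finset.mem_insert, Finset.mem_map_equiv, Finset.mem_filter]
    simp only [Finset.mem_univ, true_and, he, Equiv.prodCongr_symm, Equiv.symm_swap, Equiv.prodCongr_apply,
      Prod.map_apply, Equiv.Perm.mul_apply, Prod.mk.injEq]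
    by_cases h1 : a = p ∧ c = q
    · obtain ⟨rfl, rfl⟩ := h1
      simp [hlt, hw]
    by_cases h2 : a = q ∧ c = p
    · obtain ⟨rfl, rfl⟩ := h2
      simp [hlt, hlt.not_gt, hw.not_gt, hlt.ne']
    · rw [swap_lt_swap_iff hpq h1 h2]
      simp [h1]
  rw [inversionCount, hset, Finset.card_insert_of_notMem, Finset.card_map, inversionCount]
  simp [Finset.mem_map_equiv, he, hlt.not_gt]

theorem inversionCount_le_mul_swap_add_one (w : Equiv.Perm (Fin n)) {p q : Fin n}
    (hpq : (p : ℕ) + 1 = q) : inversionCount w ≤ inversionCount (w * Equiv.swap p q) + 1 := by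
  have hne : p ≠ q := by rintro rfl; omega
  rcases (w.injective.ne hne).lt_or_gt with h | h
  · rw [inversionCount_mul_swap hpq h]
    omega
  · have := inversionCount_mul_swap (w := w * Equiv.swap p q) hpq (by simpa using h)
    rw [mul_assoc, Equiv.swap_mul_self, mul_one] at this
    omega

/-- `F` is supported on permutations with at most as many inversions as the permutation whose
values are given by `f`, and its value at this permutation is `c`. -/
def HasLeadingTerm (F : Equiv.Perm (Fin n) → R) (f : ℕ → ℕ) (c : R) : Prop :=
  ∃ v : Equiv.Perm (Fin n), (∀ k, (v k : ℕ) = f k) ∧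
    (∀ w, inversionCount v < inversionCount w → F w = 0) ∧ F v = c

theorem HasLeadingTerm.congr {F : Equiv.Perm (Fin n) → R} {f g : ℕ → ℕ} {c : R}
    (h : HasLeadingTerm F f c) (hfg : ∀ k < n, f k = g k) : HasLeadingTerm F g c := by
  obtain ⟨v, h1, h2⟩ := h
  exact ⟨v, fun k => (h1 k).trans (hfg k k.2), h2⟩

/-- At an ascent the leading permutation gains one inversion. `F` vanishes at the new one, so only
the swap term, with factor `x`, contributes there. -/
theorem HasLeadingTerm.hFactor {F : Equiv.Perm (Fin n) → R} {f : ℕ → ℕ} {c : R}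
    (h : HasLeadingTerm F f c) (b x : R) {j : ℕ} (hj : j + 1 < n) (hf : f j < f (j + 1)) :
    HasLeadingTerm (hFactor (simpleOp n b) j x F) (f ∘ Equiv.swap j (j + 1)) (x * c) := by
  obtain ⟨v, hv, hF, rfl⟩ := h
  set p : Fin n := ⟨j, Nat.lt_of_succ_lt hj⟩ with hp
  set q : Fin n := ⟨j + 1, hj⟩ with hq
  have hpq : (p : ℕ) + 1 = q := rfl
  have hvlt : v p < v q := by
    rw [Fin.lt_def, hv, hv]
    exact hf
  have hinv := inversionCount_mul_swap hpq hvlt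
  have hop (w : Equiv.Perm (Fin n)) : Grothendieck.hFactor (simpleOp n b) j x F w =
      F w + x * if w q < w p then F (w * Equiv.swap p q) + b * F w else 0 := by
    simp [Grothendieck.hFactor, simpleOp, hj, descentOp_apply, hp, hq]
  refine ⟨v * Equiv.swap p q, fun k => ?_, fun w hw => ?_, ?_⟩
  · rw [Equiv.Perm.mul_apply, hv, Function.comp_apply]
    congr 1
    simp only [Equiv.swap_apply_def, hp, hq, Fin.ext_iff]
    split_ifs <;> rfl
  · have := inversionCount_le_mul_swap_add_one w hpq
    rw [hop, hF w (by omega), hF (w * Equiv.swap p q) (by omega)]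
    simp
  · rw [hop, hF (v * Equiv.swap p q) (by omega)]
    simp [hvlt, mul_assoc]

/-- The values of the permutation that sends the first `i` positions to the `i` largest values in
decreasing order and is increasing on the others. -/
def reversedPrefix (n i k : ℕ) : ℕ := if k < i then n - 1 - k else k - i

/-- The `k` factors move the largest value not yet placed, `n - 1 - i`, from the last position left
to position `j`, each step contributing one `x`. -/
theorem HasLeadingTerm.segment {F : Equiv.Perm (Fin n) → R} {i : ℕ} {c : R}
    (h : HasLeadingTerm F (reversedPrefix n i) c) (b x : R) {j k : ℕ} (hij : i ≤ j)
    (hjk : j + k + 1 = n) :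
    HasLeadingTerm (segment (simpleOp n b) j k x F)
      (fun l => if l < j then reversedPrefix n i l else if l = j then n - 1 - i
        else l - 1 - i) (x ^ k * c) := by
  induction k generalizing j with
  | zero =>
    simp only [pow_zero, one_mul, Grothendieck.segment, Module.End.one_apply]
    refine h.congr fun l hl => ?_
    simp only [reversedPrefix]
    split_ifs <;> omega
  | succ k ih =>
    have := (ih (j := j + 1) (by omega) (by omega)).hFactor b x (j := j) (by omega) (by
      simp [reversedPrefix, hij.not_gt]; omega)
    rw [Grothendieck.segment, Module.End.mul_apply, pow_succ', mul_assoc]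
    refine this.congr fun l hl => ?_
    simp only [reversedPrefix, Function.comp_apply, Equiv.swap_apply_def]
    split_ifs <;> omega

theorem HasLeadingTerm.staircase {F : Equiv.Perm (Fin n) → R} {i : ℕ} {c : R}
    (h : HasLeadingTerm F (reversedPrefix n i) c) (b : R) (X : ℕ → R) {k : ℕ}
    (hik : i + k + 1 = n) :
    HasLeadingTerm (staircase (simpleOp n b) X i k F) (reversedPrefix n (i + k))
      ((∏ l ∈ Finset.range k, X (i + l) ^ (k - l)) * c) := by
  induction k generalizing i F c with
  | zero => simpa [Grothendieck.staircase] using h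
  | succ k ih =>
    have h1 : HasLeadingTerm (Grothendieck.segment (simpleOp n b) i (k + 1) (X i) F)
        (reversedPrefix n (i + 1)) (X i ^ (k + 1) * c) := by
      refine (h.segment b (X i) (le_refl i) (k := k + 1) (by omega)).congr fun l hl => ?_
      simp only [reversedPrefix]
      split_ifs <;> omega
    have h2 := ih h1 (by omega)
    rw [Grothendieck.staircase, Module.End.mul_apply, Finset.prod_range_succ',
      show i + (k + 1) = i + 1 + k by omega]
    convert h2 using 1
    rw [mul_assoc]
    congr 1
    refine Finset.prod_congr rfl fun l hl => ?_
    rw [show i + (l + 1) = i + 1 + l by omega, Nat.add_sub_add_right]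

theorem hasLeadingTerm_single :
    HasLeadingTerm (Pi.single 1 1 : Equiv.Perm (Fin n) → R) (reversedPrefix n 0) 1 := by
  refine ⟨1, fun k => by simp [reversedPrefix], fun w hw => ?_, by simp⟩
  have : w ≠ 1 := by rintro rfl; exact hw.ne rfl
  simp [this]

/-- The coefficient of the longest permutation in the generating function. -/
theorem generating_revPerm (b : R) (X : ℕ → R) :
    generating n b X Fin.revPerm = ∏ k : Fin n, X k ^ (n - 1 - (k : ℕ)) := by
  cases n with
  | zero => simp [generating, staircase, Subsingleton.elim (Fin.revPerm : Equiv.Perm (Fin 0)) 1]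
  | succ n =>
    obtain ⟨v, hv, -, h⟩ := (hasLeadingTerm_single (R := R) (n := n + 1)).staircase b X (k := n)
      (by omega)
    have : v = Fin.revPerm := by
      ext k
      rw [hv, Fin.revPerm_apply, Fin.val_rev]
      simp only [reversedPrefix]
      split_ifs <;> omega
    rw [this] at h
    rw [generating, Nat.add_sub_cancel, h, Finset.prod_range fun l => X (0 + l) ^ (n - l),
      Fin.prod_univ_castSucc]
    simp

end TopCoefficient

/-! ### The isobaric recursion and the specialization -/

section Recursion

open MvPolynomial

variable {n : ℕ}

/-- The variables `x_k` for `k < n`, followed by ones. -/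
noncomputable def variableSeq (n k : ℕ) : MvPolynomial (Fin n) (Polynomial ℤ) :=
  if h : k < n then X ⟨k, h⟩ else 1

theorem variableSeq_of_lt {k : ℕ} (h : k < n) : variableSeq n k = X ⟨k, h⟩ := dif_pos h

theorem rename_comp_variableSeq {j : ℕ} (hj : j + 1 < n) :
    (rename (Equiv.swap (⟨j, Nat.lt_of_succ_lt hj⟩ : Fin n) ⟨j + 1, hj⟩) :
      MvPolynomial (Fin n) (Polynomial ℤ) → _) ∘ variableSeq n =
      variableSeq n ∘ Equiv.swap j (j + 1) := by
  ext1 k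
  simp only [Function.comp_apply]
  by_cases hk : k < n
  · have hk' : Equiv.swap j (j + 1) k < n := by
      rw [Equiv.swap_apply_def]
      split_ifs <;> omega
    rw [variableSeq_of_lt hk, variableSeq_of_lt hk', rename_X]
    congr 1
    simp only [Equiv.swap_apply_def, Fin.ext_iff]
    split_ifs <;> rfl
  · rw [Equiv.swap_apply_of_ne_of_ne (by omega) (by omega)]
    simp [variableSeq, hk]

theorem smul_injective_of_ne_zero {c : MvPolynomial (Fin n) (Polynomial ℤ)} (hc : c ≠ 0)
    (p q : Module.End (MvPolynomial (Fin n) (Polynomial ℤ))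
      (Equiv.Perm (Fin n) → MvPolynomial (Fin n) (Polynomial ℤ))) (h : c • p = c • q) : p = q := by
  refine LinearMap.ext fun F => funext fun w => mul_left_cancel₀ hc ?_
  simpa using congrFun (LinearMap.congr_fun h F) w

theorem one_add_C_mul_variableSeq_ne_zero (k : ℕ) :
    1 + C Polynomial.X * variableSeq n k ≠ 0 := by
  intro h
  -- Setting `β = 0` too is needed for `k ≥ n`, where the expression is `1 + β`.
  have := congrArg (fun f => (eval (fun _ => (0 : Polynomial ℤ)) f).eval 0) h
  simp at this

/-- The generating function of the Grothendieck polynomials in the variables `x_1, …, x_n`. -/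
noncomputable def genericSeries (n : ℕ) :
    Equiv.Perm (Fin n) → MvPolynomial (Fin n) (Polynomial ℤ) :=
  generating n (C Polynomial.X) (variableSeq n)

theorem isobaric_genericSeries (w : Equiv.Perm (Fin n)) {j : ℕ} (hj : j + 1 < n)
    (hw : w ⟨j, Nat.lt_of_succ_lt hj⟩ < w ⟨j + 1, hj⟩) :
    isobaric ⟨j, Nat.lt_of_succ_lt hj⟩ ⟨j + 1, hj⟩
      (genericSeries n (w * Equiv.swap ⟨j, Nat.lt_of_succ_lt hj⟩ ⟨j + 1, hj⟩)) =
    genericSeries n w := by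
  set p : Fin n := ⟨j, Nat.lt_of_succ_lt hj⟩ with hp
  set q : Fin n := ⟨j + 1, hj⟩ with hq
  have hne : p ≠ q := by simp [hp, hq]
  have hX : (X p - X q : MvPolynomial (Fin n) (Polynomial ℤ)) ≠ 0 :=
    sub_ne_zero.2 fun h => hne (X_injective h)
  have hop (x : MvPolynomial (Fin n) (Polynomial ℤ)) (F) (v : Equiv.Perm (Fin n)) :
      hFactor (simpleOp n (C Polynomial.X)) j x F v = F v + x * if v q < v p then
        F (v * Equiv.swap p q) + C Polynomial.X * F v else 0 := by
    simp [hFactor, simpleOp, hj, descentOp_apply, hp, hq]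
  have hsym : rename (Equiv.swap p q) ∘ genericSeries n =
      generating n (C Polynomial.X) (variableSeq n ∘ Equiv.swap j (j + 1)) := by
    have := comp_generating (n := n)
      (rename (R := Polynomial ℤ) (Equiv.swap p q)).toRingHom (C Polynomial.X) (variableSeq n)
    simpa [rename_comp_variableSeq hj, hp, hq, genericSeries] using this
  have hmain := (heckeRelations_simpleOp n (C Polynomial.X)).hFactor_mul_staircase
    (smul_injective_of_ne_zero (one_add_C_mul_variableSeq_ne_zero (n := n) (j + 1))) 0 (n - 1)
    (Nat.zero_le j) (by omega)
  have hcoeff (v : Equiv.Perm (Fin n)) := congrFun (LinearMap.congr_fun hmain (Pi.single 1 1)) v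
  simp only [Module.End.mul_apply] at hcoeff
  have hgen : staircase (simpleOp n (C Polynomial.X)) (variableSeq n) 0 (n - 1) (Pi.single 1 1) =
    genericSeries n := rfl
  have hgen' : staircase (simpleOp n (C Polynomial.X)) (variableSeq n ∘ Equiv.swap j (j + 1)) 0
      (n - 1) (Pi.single 1 1) = rename (Equiv.swap p q) ∘ genericSeries n := hsym.symm
  rw [hgen, hgen', variableSeq_of_lt hj, variableSeq_of_lt (Nat.lt_of_succ_lt hj)] at hcoeff
  simp only [hop, Function.comp_apply] at hcoeff
  -- At the ascent `w` the exchange rule says that the coefficient is symmetric in the two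
  -- variables. At `w` times the transposition it then becomes the divided-difference identity
  -- multiplied by `X p - X q`.
  have h1 := hcoeff w
  have h2 := hcoeff (w * Equiv.swap p q)
  simp only [hw.not_gt, if_false, mul_zero, add_zero] at h1
  simp only [Equiv.Perm.mul_apply, Equiv.swap_apply_left, Equiv.swap_apply_right, hw, if_true,
    mul_assoc w, Equiv.swap_mul_self, mul_one] at h2
  apply mul_left_cancel₀ hX
  rw [isobaric, X_sub_X_mul_dividedDiff]
  simp only [map_mul, map_add, map_one, rename_C, rename_X, Equiv.swap_apply_right]
  rw [← h1] at h2
  linear_combination h2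

open scoped Classical in
theorem grothendieck_eq_genericSeries (w : Equiv.Perm (Fin n)) :
    grothendieck w = genericSeries n w := by
  induction h : ∑ k : Fin n, (k : ℕ) * (w k : ℕ) using Nat.strong_induction_on generalizing w with
  | _ m ih =>
    subst h
    rw [grothendieck]
    split_ifs with hw
    · subst hw
      rw [genericSeries, generating_revPerm]
      exact Finset.prod_congr rfl fun k _ => by rw [variableSeq_of_lt k.2]
    · have hi := Nat.find_spec (exists_isAscent hw)
      dsimp only
      rw [ih _ (sum_swap_lt (Fin.mk_lt_mk.2 (Nat.lt_succ_self _)) hi.2) _ rfl]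
      exact isobaric_genericSeries w hi.1 hi.2

theorem principalSpecialization_eq_generating (w : Equiv.Perm (Fin n)) :
    principalSpecialization w = generating n Polynomial.X (fun _ => 1) w := by
  have h := comp_generating (n := n) (eval fun _ => (1 : Polynomial ℤ)) (C Polynomial.X)
    (variableSeq n)
  have hX : eval (fun _ => (1 : Polynomial ℤ)) ∘ variableSeq n = fun _ => 1 := by
    ext1 k
    simp only [Function.comp_apply, variableSeq]
    split_ifs <;> simp
  rw [hX, eval_C] at h
  rw [principalSpecialization, grothendieck_eq_genericSeries, genericSeries, ← h]
  rfl

end Recursion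

end Grothendieck

theorem proposition2p3 (n : ℕ) (w : Equiv.Perm (Fin n)) :
    Grothendieck.principalSpecialization w = Grothendieck.principalSpecialization w⁻¹ := by
  rw [Grothendieck.principalSpecialization_eq_generating,
    Grothendieck.principalSpecialization_eq_generating, Grothendieck.generating_const_inv]
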